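/- **Setting.** Consider a directed graph with finitely many arcs ($A$ of them), origin-destination (OD) pairs $k$ with demand $q_k$ and longest acceptable travel time $\tau_k$, and finitely many directed paths $r=1,\dots,N$, each of which connects one OD pair $k(r)$. Let $\Pi$ be the OD-path incidence matrix ($\pi_{kr}=1$ if path $r$ connects the pair $k$, else $0$), $\Delta$ the arc-path incidence matrix ($\delta_{ar}=1$ if arc $a$ is on path $r$, else $0$), and $D=\{f\in\mathbb R^N_+:\Pi f=q\}$. Let $N_D(f)=\{w:\langle w,g-f\rangle\le 0\ \forall g\in D\}$ for $f\in D$ and $N_D(f)=\emptyset$ for $f\notin D$. Let $T(v,\xi)\in\mathbb R^A$ be the vector of arc travel times for the arc flow $v\in\mathbb R^A$ and the random factors $\xi\in\mathbb R^m$, and $C(f,\xi)=\Delta^\top T(\Delta f,\xi)$ the vector of path travel times. Fix $t>0$, real weights $\theta_0,\theta_1,\theta_2$ and $d\in\mathbb R^N$, and let $$\hat u_r(f,C(f,\xi),t)=\theta_0d_r+\theta_1C_r(f,\xi)+\theta_2\,h(C_r(f,\xi)-\tau_{k(r)},t),\qquad r=1,\dots,N,$$ where $h(z,t)=z$ for $z>t$,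 $h(z,t)=\frac{1}{4t}(z+t)^2$ for $-t\le z\le t$, and $h(z,t)=0$ for $z<-t$. For a probability measure $Q$ on $\mathbb R^m$ let $\hat\varphi_t(f,Q)=E_Q[\hat u(f,C(f,\xi),t)]$, and let $F_t(Q)$ be the set of those $f$ for which this expectation exists and $0\in\hat\varphi_t(f,Q)+N_D(f)$. For a set-valued map $\Gamma$ and $u\in\Gamma(z)$, the proto-derivative is $$\Gamma'_{z,u}(d)=\limsup_{\varepsilon\downarrow0,\ d'\to d}\frac{\Gamma(z+\varepsilon d')-u}{\varepsilon}\qquad\text{(outer limit of sets)}.$$ The generalized influence function $\mathrm{GIF}(\tilde\xi;F_t(\cdot),P,f^*)$ is the proto-derivative of $\varepsilon\mapsto F_t((1-\varepsilon)P+\varepsilon\delta_{\tilde\xi})$ at $0$ for $f^*\in F_t(P)$, in the direction $1$, and $\|\mathrm{GIF}\|$ is the least $\nu\in[0,\infty]$ with $\|\eta\|\le\nu$ for all $\eta\in\mathrm{GIF}$. A set-valued map $\Upsilon$ on $\mathbb R^N$ is strongly metrically regular at $\bar f$ for $\bar g$ with modulus $\gamma>0$ if $d(f,\Upsilon^{-1}(g))\le\gamma\,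 d(g,\Upsilon(f))$ for all $(f,g)$ in a neighbourhood of $(\bar f,\bar g)$ (with $d(\cdot,\emptyset)=\infty$) and there are neighbourhoods $V$ of $\bar f$ and $W$ of $\bar g$ such that for every $g\in W$ the set $V\cap\Upsilon^{-1}(g)$ has exactly one element. **Assumptions.** $P$ is a probability measure on $\mathbb R^m$ concentrated on a compact set $\Xi$. There is a convex compact set $\mathbb F_t\subset\mathbb R^N$ that contains $F_t(P)+b\mathcal B$ for some $b>0$, where $\mathcal B$ is the unit ball. Let $\mathbb V_t=\Delta(\mathbb F_t)$. For every $v$ the map $T(v,\cdot)$ is measurable on $\mathbb R^m$, and for every $\xi\in\mathbb R^m$ the map $T(\cdot,\xi)$ is continuous. For every $\xi\in\Xi$, (a) $T(\cdot,\xi)$ is continuously differentiable; (b) $\sup_{v\in\mathbb V_t}\|T(v,\xi)\|\le\Phi_1(\xi)$; (c) $\|T(v,\xi)-T(v',\xi)\|\le\Phi_2(\xi)\|v-v'\|$ for all $v,v'\in\mathbb V_t$; here $\Phi_1$ and $\Phi_2>0$ are $P$-integrable. **Theorem.** Let $f^*_t\in F_t(P)$ and $\hat u^*=-\hat\varphi_t(f^*_t,P)$.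 Suppose that the linearized generalized equation $$0\in E_P\big[\nabla_f\hat u(f^*_t,C(f^*_t,\xi),t)\big]f+(N_D)'_{f^*_t,\hat u^*}(f)$$ has the unique solution $f=0$. Then: (i) $\mathrm{GIF}(\tilde\xi;F_t(\cdot),P,f^*_t)$ is bounded for every $\tilde\xi\in\mathbb R^m$. (ii) If, in addition, $f\mapsto\hat\varphi_t(f,P)+N_D(f)$ (taken to be empty where the expectation does not exist) is strongly metrically regular at $f^*_t$ for $0$ with modulus $\gamma$, then $$\sup_{\tilde\xi\in\mathbb R^m}\big\|\mathrm{GIF}(\tilde\xi;F_t(\cdot),P,f^*_t)\big\|\le\gamma\sup_{f\in\mathbb F_t,\ \tilde\xi\in\mathbb R^m}\big\|\hat\varphi_t(f,P)-\hat u(f,C(f,\tilde\xi),t)\big\|,$$ where both sides may be $+\infty$. -/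

import Mathlib

open MeasureTheory Filter Topology
open scoped ENNReal Matrix

noncomputable section

/-! ## Set-valued analysis -/

section SetValued

variable {X Y : Type*} [NormedAddCommGroup X] [NormedSpace ℝ X]
  [NormedAddCommGroup Y] [NormedSpace ℝ Y]

/-- The proto-derivative of a set-valued map `Γ` at `z` for `u`, through its limit formula
`Γ'_{z,u}(d) = limsup_{ε ↓ 0, d' → d} (Γ (z + ε d') - u) / ε`, where `limsup` is the
(Painlevé-Kuratowski) outer limit of sets: the set of all limits of sequences
`ηₙ ∈ (Γ (z + εₙ dₙ) - u) / εₙ` with `εₙ ↓ 0` and `dₙ → d`. -/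
def protoDeriv (Γ : X → Set Y) (z : X) (u : Y) (d : X) : Set Y :=
  {η | ∃ (ε : ℕ → ℝ) (d' : ℕ → X) (η' : ℕ → Y),
    (∀ n, 0 < ε n) ∧ Tendsto ε atTop (𝓝 0) ∧ Tendsto d' atTop (𝓝 d) ∧
    Tendsto η' atTop (𝓝 η) ∧ ∀ n, u + ε n • η' n ∈ Γ (z + ε n • d' n)}

/-- The inverse of a set-valued map. -/
def setInverse (Γ : X → Set Y) (y : Y) : Set X := {x | y ∈ Γ x}

/-- `Γ` is metrically regular at `x₀` for `y₀` with regularity modulus `α`. Distances are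
extended distances, so the distance to the empty set is `∞`. -/
def MetricallyRegular (Γ : X → Set Y) (x₀ : X) (y₀ : Y) (α : ℝ) : Prop :=
  0 < α ∧ ∃ V ∈ 𝓝 x₀, ∃ W ∈ 𝓝 y₀, ∀ x ∈ V, ∀ y ∈ W,
    Metric.infEDist x (setInverse Γ y) ≤ ENNReal.ofReal α * Metric.infEDist y (Γ x)

/-- `Γ` is strongly metrically regular at `x₀` for `y₀` with regularity modulus `α`. -/
def StronglyMetricallyRegular (Γ : X → Set Y) (x₀ : X) (y₀ : Y) (α : ℝ) : Prop :=
  MetricallyRegular Γ x₀ y₀ α ∧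
    ∃ V ∈ 𝓝 x₀, ∃ W ∈ 𝓝 y₀, ∀ y ∈ W, ∃! x, x ∈ V ∩ setInverse Γ y

end SetValued

/-- The normal cone to a set `D` at `f` (empty when `f ∉ D`). -/
def normalCone {E : Type*} [NormedAddCommGroup E] [InnerProductSpace ℝ E]
    (D : Set E) (f : E) : Set E :=
  {w | f ∈ D ∧ ∀ g ∈ D, inner ℝ w (g - f) ≤ 0}

/-! ## The transportation network -/

/-- The list `l` of arcs is a directed walk from `x` to `y`, in the directed graph whose arcs run
from `tail a` to `head a`. -/
def IsDirectedWalk {Node Arc : Type*} (tail head : Arc → Node) : Node → List Arc → Node → Prop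
  | x, [], y => x = y
  | x, a :: l, y => tail a = x ∧ IsDirectedWalk tail head (head a) l y

/-- A directed graph with origin-destination (OD) pairs and, for each of them, a family of directed
paths that connect it (the paths `r` with `od r = k` connect the pair `k`). -/
structure TransportNetwork (Node Arc OD Path : Type*) where
  tail : Arc → Node
  head : Arc → Node
  origin : OD → Node
  destination : OD → Node
  od : Path → OD
  arcs : Path → List Arc
  connects : ∀ r, IsDirectedWalk tail head (origin (od r)) (arcs r) (destination (od r))

namespace TransportNetwork

variable {Node Arc OD Path : Type*} (G : TransportNetwork Node Arc OD Path)

open Classical in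
/-- The OD-path incidence matrix `Π`. -/
def odIncidence : Matrix OD Path ℝ := Matrix.of fun k r => if G.od r = k then 1 else 0

open Classical in
/-- The arc-path incidence matrix `Δ`. -/
def arcIncidence : Matrix Arc Path ℝ := Matrix.of fun a r => if a ∈ G.arcs r then 1 else 0

/-- The set `D` of feasible path flows for the demand vector `q`. -/
def feasible [Fintype Path] (q : OD → ℝ) : Set (EuclideanSpace ℝ Path) :=
  {f | (∀ r, 0 ≤ f r) ∧ G.odIncidence *ᵥ f.ofLp = q}

/-- The arc flow `v = Δ f` of a path flow `f`. -/
def arcFlow [Fintype Path] (f : EuclideanSpace ℝ Path) : EuclideanSpace ℝ Arc :=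
  WithLp.toLp 2 (G.arcIncidence *ᵥ f.ofLp)

end TransportNetwork

/-! ## The modified late arrival penalised user equilibrium (MLAPUE) -/

/-- The smoothed lateness penalty `h(z, t)`, an approximation of `max z 0` for small `t > 0`. -/
def latePenalty (z t : ℝ) : ℝ :=
  if t < z then z else if -t ≤ z then (z ^ 2 + 2 * z * t + t ^ 2) / (4 * t) else 0

/-- The data of the model: a network, the demand `q`, the weights `θ₀`, `θ₁`, `θ₂`, the composite
attributes `attr` of the paths (such as distance), the longest acceptable travel times `τ` of the
OD pairs, and the vector `T v ξ` of arc travel times for the arc flow `v` and the value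
`ξ ∈ ℝᵐ` of the random factors. -/
structure MLAPUEModel (Node Arc OD Path : Type*) (m : ℕ) where
  net : TransportNetwork Node Arc OD Path
  q : OD → ℝ
  θ₀ : ℝ
  θ₁ : ℝ
  θ₂ : ℝ
  attr : Path → ℝ
  τ : OD → ℝ
  T : EuclideanSpace ℝ Arc → EuclideanSpace ℝ (Fin m) → EuclideanSpace ℝ Arc

namespace MLAPUEModel

variable {Node Arc OD Path : Type*} [Fintype Arc] [Fintype Path] {m : ℕ}
  (M : MLAPUEModel Node Arc OD Path m)

/-- The set `D` of feasible path flows. -/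
def D : Set (EuclideanSpace ℝ Path) := M.net.feasible M.q

/-- The vector of path travel times `C(f, ξ) = Δᵀ T(Δ f, ξ)`. -/
def pathTime (f : EuclideanSpace ℝ Path) (ξ : EuclideanSpace ℝ (Fin m)) :
    EuclideanSpace ℝ Path :=
  WithLp.toLp 2 (M.net.arcIncidenceᵀ *ᵥ (M.T (M.net.arcFlow f) ξ).ofLp)

/-- The vector of path disutilities `û(f, C(f, ξ), t)`, with components
`θ₀ d_r + θ₁ C_r(f, ξ) + θ₂ h(C_r(f, ξ) - τ_k, t)`, where `k` is the OD pair of the path `r`. -/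
def disutility (t : ℝ) (f : EuclideanSpace ℝ Path) (ξ : EuclideanSpace ℝ (Fin m)) :
    EuclideanSpace ℝ Path :=
  WithLp.toLp 2 fun r => M.θ₀ * M.attr r + M.θ₁ * M.pathTime f ξ r +
    M.θ₂ * latePenalty (M.pathTime f ξ r - M.τ (M.net.od r)) t

/-- The expected disutility `φ̂_t(f, Q) = E_Q[û(f, C(f, ξ), t)]`. -/
def expDisutility (t : ℝ) (f : EuclideanSpace ℝ Path) (Q : Measure (EuclideanSpace ℝ (Fin m))) :
    EuclideanSpace ℝ Path :=
  ∫ ξ, M.disutility t f ξ ∂Q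

/-- The expected Jacobian `E_Q[∇_f û(f, C(f, ξ), t)]`. -/
def expJacobian (t : ℝ) (f : EuclideanSpace ℝ Path) (Q : Measure (EuclideanSpace ℝ (Fin m))) :
    EuclideanSpace ℝ Path →L[ℝ] EuclideanSpace ℝ Path :=
  ∫ ξ, fderiv ℝ (fun g => M.disutility t g ξ) f ∂Q

/-- The set-valued map `f ↦ φ̂_t(f, Q) + N_D(f)` (empty where the expectation does not exist). -/
def equilibriumMap (t : ℝ) (Q : Measure (EuclideanSpace ℝ (Fin m)))
    (f : EuclideanSpace ℝ Path) : Set (EuclideanSpace ℝ Path) :=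
  {y | Integrable (M.disutility t f) Q ∧
    ∃ w ∈ normalCone M.D f, y = M.expDisutility t f Q + w}

/-- The set `F_t(Q)` of modified equilibria: the solutions `f` of
`0 ∈ E_Q[û(f, C(f, ξ), t)] + N_D(f)`. -/
def equilibria (t : ℝ) (Q : Measure (EuclideanSpace ℝ (Fin m))) :
    Set (EuclideanSpace ℝ Path) :=
  {f | 0 ∈ M.equilibriumMap t Q f}

/-- The mixture `(1 - ε) P + ε δ_ξ'` (a probability measure for `0 ≤ ε ≤ 1`; only small `ε > 0`
matter below). -/
def contaminated (P : Measure (EuclideanSpace ℝ (Fin m))) (ξ' : EuclideanSpace ℝ (Fin m))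
    (ε : ℝ) : Measure (EuclideanSpace ℝ (Fin m)) :=
  ENNReal.ofReal (1 - ε) • P + ENNReal.ofReal ε • Measure.dirac ξ'

/-- The generalized influence function `GIF(ξ'; F_t(·), P, f)`: the proto-derivative at `0` for
`f`, in the direction `1`, of `ε ↦ F_t((1 - ε) P + ε δ_ξ')`. -/
def GIF (t : ℝ) (P : Measure (EuclideanSpace ℝ (Fin m))) (f : EuclideanSpace ℝ Path)
    (ξ' : EuclideanSpace ℝ (Fin m)) : Set (EuclideanSpace ℝ Path) :=
  protoDeriv (fun ε : ℝ => M.equilibria t (contaminated P ξ' ε)) 0 f 1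

/-- The norm of the generalized influence function: the least `ν` in `[0, ∞]` that bounds the norms
of its elements. -/
def normGIF (t : ℝ) (P : Measure (EuclideanSpace ℝ (Fin m))) (f : EuclideanSpace ℝ Path)
    (ξ' : EuclideanSpace ℝ (Fin m)) : ℝ≥0∞ :=
  sInf {ν | ∀ η ∈ M.GIF t P f ξ', ‖η‖ₑ ≤ ν}

end MLAPUEModel

end

/-! Write `φ` for the expected disutility under `P`, `û` for the disutility and `N` for the normal
cone map. An equilibrium `g` for the mixture with weight `s` satisfies `s (φ(g) - û(g, ξ')) ∈ φ(g) +
N(g)`: contamination is a perturbation of order `s` of the right-hand side of the original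
generalized equation.

For (i), put `g = f + ε η'`, divide by `ε` and let `ε ↓ 0`. If `φ` has derivative `J` at `f`, every
limit `η` satisfies `φ(f) - û(f, ξ') - J η ∈ N'(η)` (`GIF_subset`). The graph of a proto-derivative
is a closed cone, so an unbounded family of solutions, normalised, would accumulate at a unit vector
solving the homogeneous equation, which has only the solution `0` (`isBounded_linearized_preimage`).
Differentiability of `φ` (`hasFDerivAt_expDisutility`) comes from dominated differentiation: the
smoothed penalty is differentiable and Lipschitz, and the travel times have an integrable Lipschitz
constant.

For (ii), strong regularity gives `‖g - f‖ ≤ γ s ‖φ(g) - û(g, ξ')‖`; dividing by `ε` bounds `‖η‖` by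
the residual at `f` alone, and `f ∈ 𝔽`. -/

/-! ## Preliminaries on derivatives -/

theorem hasDerivAt_sq_max_zero (x : ℝ) :
    HasDerivAt (fun y : ℝ => max y 0 ^ 2) (2 * max x 0) x := by
  rw [hasDerivAt_iff_isLittleO]
  -- In each of the four sign cases the first-order remainder lies between `0` and `(y - x) ^ 2`.
  refine Asymptotics.IsBigO.trans_isLittleO (g := fun y : ℝ => (y - x) ^ 2) ?_ ?_
  · refine Asymptotics.IsBigO.of_bound 1 (Eventually.of_forall fun y => ?_)
    rw [one_mul, Real.norm_eq_abs, Real.norm_eq_abs, abs_of_nonneg (sq_nonneg (y - x)), abs_le,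
      smul_eq_mul]
    rcases le_total x 0 with hx | hx <;> rcases le_total y 0 with hy | hy <;>
      simp only [max_eq_left, max_eq_right, hx, hy] <;> constructor <;> nlinarith
  · simpa using Asymptotics.isLittleO_pow_sub_sub x (one_lt_two)

/-- Removes the case distinction: smoothness at the break points `±t` reduces to that of the squared
positive part. -/
theorem latePenalty_eq {t : ℝ} (ht : 0 < t) (z : ℝ) :
    latePenalty z t = (max (z + t) 0 ^ 2 - max (z - t) 0 ^ 2) / (4 * t) := by
  unfold latePenalty
  split_ifs with h₁ h₂
  · rw [max_eq_left (by linarith), max_eq_left (by linarith)]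
    field_simp
    ring
  · rw [max_eq_left (by linarith), max_eq_right (by linarith)]
    ring
  · rw [max_eq_right (by linarith), max_eq_right (by linarith)]
    simp

theorem hasDerivAt_latePenalty {t : ℝ} (ht : 0 < t) (z : ℝ) :
    HasDerivAt (fun z => latePenalty z t)
      ((2 * max (z + t) 0 - 2 * max (z - t) 0) / (4 * t)) z := by
  simp only [latePenalty_eq ht]
  exact (((hasDerivAt_sq_max_zero (z + t)).comp_add_const z t).sub
    ((hasDerivAt_sq_max_zero (z - t)).comp_sub_const z t)).div_const _

theorem lipschitzWith_latePenalty {t : ℝ} (ht : 0 < t) :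
    LipschitzWith 1 fun z => latePenalty z t := by
  refine lipschitzWith_of_nnnorm_deriv_le
    (fun z => (hasDerivAt_latePenalty ht z).differentiableAt) fun z => ?_
  rw [(hasDerivAt_latePenalty ht z).deriv, ← NNReal.coe_le_coe, coe_nnnorm, Real.norm_eq_abs,
    abs_div, abs_of_pos (show 0 < 4 * t by linarith), div_le_iff₀ (by linarith), abs_le]
  push_cast
  rcases le_total (z + t) 0 with hx | hx <;> rcases le_total (z - t) 0 with hy | hy <;>
    simp only [max_eq_left, max_eq_right, hx, hy] <;> constructor <;> linarith

/-- Directional derivatives are a.e. limits of measurable difference quotients, and in finite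
dimension a linear map is recovered from its values on a basis. -/
theorem aestronglyMeasurable_fderiv_of_ae_differentiableAt {Ω E F : Type*} [MeasurableSpace Ω]
    {μ : Measure Ω} [NormedAddCommGroup E] [NormedSpace ℝ E] [FiniteDimensional ℝ E]
    [NormedAddCommGroup F] [NormedSpace ℝ F] {u : E → Ω → F} {x : E}
    (hmeas : ∀ y, AEStronglyMeasurable (u y) μ)
    (hdiff : ∀ᵐ ω ∂μ, DifferentiableAt ℝ (fun y => u y ω) x) :
    AEStronglyMeasurable (fun ω => fderiv ℝ (fun y => u y ω) x) μ := by
  have happly (v : E) : AEStronglyMeasurable (fun ω => fderiv ℝ (fun y => u y ω) x v) μ := by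
    refine aestronglyMeasurable_of_tendsto_ae (u := atTop)
      (f := fun (n : ℕ) ω => (n : ℝ) • (u (x + (n : ℝ)⁻¹ • v) ω - u x ω))
      (fun n => ((hmeas _).sub (hmeas _)).const_smul _) ?_
    filter_upwards [hdiff] with ω hω
    exact (hω.hasFDerivAt.lim_real v).comp tendsto_natCast_atTop_atTop
  let b := Module.finBasis ℝ E
  let c i : E →L[ℝ] ℝ := LinearMap.toContinuousLinearMap (b.coord i)
  have hsum (L : E →L[ℝ] F) :
      L = ∑ i, ContinuousLinearMap.smulRightL ℝ E F (c i) (L (b i)) := by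
    ext v
    conv_lhs => rw [← b.sum_repr v, map_sum]
    simp [c]
  rw [show (fun ω => fderiv ℝ (fun y => u y ω) x) = fun ω => ∑ i,
      ContinuousLinearMap.smulRightL ℝ E F (c i) (fderiv ℝ (fun y => u y ω) x (b i)) from
    funext fun ω => hsum _]
  exact Finset.aestronglyMeasurable_fun_sum _ fun i _ =>
    (ContinuousLinearMap.smulRightL ℝ E F (c i)).continuous.comp_aestronglyMeasurable
      (happly (b i))

/-! ## The graph of the proto-derivative is a closed cone -/

section ProtoDeriv

variable {X Y : Type*} [NormedAddCommGroup X] [NormedSpace ℝ X]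
  [NormedAddCommGroup Y] [NormedSpace ℝ Y] {Γ : X → Set Y} {z : X} {u : Y}

/-- Replacing the step `ε` by `ε / c` leaves the points of the graph of `Γ` unchanged. -/
theorem smul_mem_protoDeriv {d : X} {η : Y} (h : η ∈ protoDeriv Γ z u d) {c : ℝ} (hc : 0 < c) :
    c • η ∈ protoDeriv Γ z u (c • d) := by
  obtain ⟨ε, d', η', hε, hε0, hd, hη, hmem⟩ := h
  refine ⟨fun n => ε n / c, fun n => c • d' n, fun n => c • η' n, fun n => div_pos (hε n) hc,
    by simpa using hε0.div_const c, hd.const_smul c, hη.const_smul c, fun n => ?_⟩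
  simpa only [smul_smul, div_mul_cancel₀ _ hc.ne'] using hmem n

/-- Diagonal argument: from the `n`-th approximating sequence take one term that is `1 / (n +
1)`-close. -/
theorem mem_protoDeriv_of_tendsto {d : ℕ → X} {η : ℕ → Y} {d₀ : X} {η₀ : Y}
    (h : ∀ n, η n ∈ protoDeriv Γ z u (d n)) (hd : Tendsto d atTop (𝓝 d₀))
    (hη : Tendsto η atTop (𝓝 η₀)) : η₀ ∈ protoDeriv Γ z u d₀ := by
  have key (n : ℕ) : ∃ (ε : ℝ) (d' : X) (η' : Y), 0 < ε ∧ ε < 1 / ((n : ℝ) + 1) ∧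
      dist d' (d n) < 1 / ((n : ℝ) + 1) ∧ dist η' (η n) < 1 / ((n : ℝ) + 1) ∧
      u + ε • η' ∈ Γ (z + ε • d') := by
    have hn : (0 : ℝ) < 1 / ((n : ℝ) + 1) := Nat.one_div_pos_of_nat
    obtain ⟨ε, d', η', hε, hε0, hd', hη', hmem⟩ := h n
    obtain ⟨k, h₁, h₂, h₃⟩ := ((hε0.eventually_lt_const hn).and
      ((Metric.tendsto_nhds.1 hd' _ hn).and (Metric.tendsto_nhds.1 hη' _ hn))).exists
    exact ⟨ε k, d' k, η' k, hε k, h₁, h₂, h₃, hmem k⟩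
  choose ε d' η' hε hε1 hd' hη' hmem using key
  have h0 := tendsto_one_div_add_atTop_nhds_zero_nat (𝕜 := ℝ)
  refine ⟨ε, d', η', hε, squeeze_zero (fun n => (hε n).le) (fun n => (hε1 n).le) h0, ?_, ?_, hmem⟩
  · exact (tendsto_iff_of_dist
      (squeeze_zero (fun _ => dist_nonneg) (fun n => (hd' n).le) h0)).2 hd
  · exact (tendsto_iff_of_dist
      (squeeze_zero (fun _ => dist_nonneg) (fun n => (hη' n).le) h0)).2 hη

/-- If the linearized generalized equation has at most the solution `0`, then the linearized map
has bounded preimages of points. -/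
theorem isBounded_linearized_preimage [FiniteDimensional ℝ X] (J : X →L[ℝ] Y)
    (h : ∀ g, ∀ w ∈ protoDeriv Γ z u g, J g + w = 0 → g = 0) (p : Y) :
    Bornology.IsBounded {g | p - J g ∈ protoDeriv Γ z u g} := by
  by_contra hb
  have hlarge (n : ℕ) : ∃ g, p - J g ∈ protoDeriv Γ z u g ∧ (n : ℝ) + 1 ≤ ‖g‖ := by
    by_contra! hn
    exact hb (isBounded_iff_forall_norm_le.2 ⟨n + 1, fun g hg => (hn g hg).le⟩)
  choose g hg hgn using hlarge
  have hpos (n : ℕ) : 0 < ‖g n‖ := lt_of_lt_of_le (by positivity) (hgn n)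
  have hinv : Tendsto (fun n => ‖g n‖⁻¹) atTop (𝓝 0) := by
    refine squeeze_zero (fun n => by positivity) (fun n => ?_)
      (tendsto_one_div_add_atTop_nhds_zero_nat (𝕜 := ℝ))
    rw [one_div]
    exact inv_anti₀ (by positivity) (hgn n)
  have : ProperSpace X := FiniteDimensional.proper_real X
  obtain ⟨e, he, φ, hφ, hlim⟩ := (isCompact_sphere (0 : X) 1).tendsto_subseq
    (x := fun n => ‖g n‖⁻¹ • g n) fun n => by
      simp [norm_smul, inv_mul_cancel₀ (hpos n).ne']
  -- Scaling by `‖g n‖⁻¹` turns the right-hand side `p` into `‖g n‖⁻¹ • p`, which vanishes in the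
  -- limit.
  have hmem : -J e ∈ protoDeriv Γ z u e := by
    refine mem_protoDeriv_of_tendsto
      (fun n => smul_mem_protoDeriv (hg (φ n)) (inv_pos.2 (hpos (φ n)))) hlim ?_
    have h₁ := ((hinv.comp hφ.tendsto_atTop).smul_const p).sub
      ((J.continuous.tendsto e).comp hlim)
    simpa [Function.comp_def, smul_sub] using h₁
  have := h e _ hmem (by simp)
  simp [this] at he

end ProtoDeriv

/-- Strong metric regularity bounds the distance to the reference point by the residual. -/
theorem StronglyMetricallyRegular.eventually_norm_sub_le {X Y : Type*} [NormedAddCommGroup X]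
    [NormedSpace ℝ X] [NormedAddCommGroup Y] [NormedSpace ℝ Y] {Γ : X → Set Y} {x₀ : X} {y₀ : Y}
    {α : ℝ} (h : StronglyMetricallyRegular Γ x₀ y₀ α) (h₀ : y₀ ∈ Γ x₀) :
    ∀ᶠ x in 𝓝 x₀, ∀ y ∈ Γ x, ‖x - x₀‖ ≤ α * ‖y - y₀‖ := by
  obtain ⟨⟨hα, V, hV, W, hW, hreg⟩, V', hV', W', hW', huniq⟩ := h
  obtain ⟨r, hr, hball⟩ := Metric.mem_nhds_iff.1 hV'
  filter_upwards [hV, Metric.ball_mem_nhds x₀ (half_pos hr)] with x hxV hxr y hy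
  have h₁ : edist x x₀ ≤ Metric.infEDist x (setInverse Γ y₀) := by
    refine Metric.le_infEDist.2 fun x' hx' => ?_
    by_cases hx'V : x' ∈ V'
    · rw [(huniq y₀ (mem_of_mem_nhds hW')).unique ⟨hx'V, hx'⟩ ⟨mem_of_mem_nhds hV', h₀⟩]
    -- A solution outside `V'` is at least `r` from `x₀`, hence more than `r / 2` from `x`, so it is
    -- farther from `x` than `x₀` is.
    · have h₂ : r ≤ dist x' x₀ := not_lt.1 fun hlt => hx'V (hball hlt)
      rw [edist_dist, edist_dist]
      refine ENNReal.ofReal_le_ofReal ?_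
      have := dist_triangle_left x' x₀ x
      rw [Metric.mem_ball] at hxr
      linarith
  have h₂ := h₁.trans ((hreg x hxV y₀ (mem_of_mem_nhds hW)).trans
    (mul_le_mul_right (Metric.infEDist_le_edist_of_mem hy) _))
  rw [edist_dist, edist_dist, ← ENNReal.ofReal_mul hα.le,
    ENNReal.ofReal_le_ofReal_iff (by positivity), dist_eq_norm, dist_eq_norm,
    norm_sub_rev y₀] at h₂
  exact h₂

/-! ## The expected disutility -/

namespace MLAPUEModel

variable {Node Arc OD Path : Type*} [Fintype Path] {m : ℕ}
  (M : MLAPUEModel Node Arc OD Path m) {t : ℝ}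

/-- The path disutilities as a function of the path travel times. -/
noncomputable def timeDisutility (t : ℝ) (c : EuclideanSpace ℝ Path) : EuclideanSpace ℝ Path :=
  WithLp.toLp 2 fun r => M.θ₀ * M.attr r + M.θ₁ * c r +
    M.θ₂ * latePenalty (c r - M.τ (M.net.od r)) t

theorem differentiable_timeDisutility (ht : 0 < t) : Differentiable ℝ (M.timeDisutility t) := by
  intro c
  rw [differentiableAt_piLp]
  intro r
  have hr : DifferentiableAt ℝ (fun c : EuclideanSpace ℝ Path => c r) c := by fun_prop
  have hp : DifferentiableAt ℝ (fun z => latePenalty z t) (c r - M.τ (M.net.od r)) :=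
    (hasDerivAt_latePenalty ht _).differentiableAt
  exact ((hr.const_mul M.θ₁).const_add _).add
    ((hp.comp c (hr.sub_const (M.τ (M.net.od r)))).const_mul M.θ₂)

theorem exists_lipschitzWith_timeDisutility (ht : 0 < t) :
    ∃ K, LipschitzWith K (M.timeDisutility t) := by
  have hr (r : Path) : LipschitzWith (‖M.θ₁‖₊ * 1 + ‖M.θ₂‖₊ * 1)
      fun c : EuclideanSpace ℝ Path => M.θ₀ * M.attr r + M.θ₁ * c r +
        M.θ₂ * latePenalty (c r - M.τ (M.net.od r)) t := by
    refine LipschitzWith.of_dist_le_mul fun c c' => ?_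
    have h₁ : |c r - c' r| ≤ dist c c' := by
      rw [dist_eq_norm]
      exact PiLp.norm_apply_le (c - c') r
    have h₂ := (lipschitzWith_latePenalty ht).dist_le_mul (c r - M.τ (M.net.od r))
      (c' r - M.τ (M.net.od r))
    rw [NNReal.coe_one, one_mul, Real.dist_eq, Real.dist_eq, sub_sub_sub_cancel_right] at h₂
    rw [Real.dist_eq]
    calc _ = |M.θ₁ * (c r - c' r) + M.θ₂ * (latePenalty (c r - M.τ (M.net.od r)) t -
            latePenalty (c' r - M.τ (M.net.od r)) t)| := by ring_nf
      _ ≤ |M.θ₁| * dist c c' + |M.θ₂| * dist c c' := by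
          refine (abs_add_le _ _).trans ?_
          rw [abs_mul, abs_mul]
          gcongr
          exact h₂.trans h₁
      _ = _ := by
          push_cast
          simp only [Real.norm_eq_abs]
          ring
  exact ⟨_, (PiLp.lipschitzWith_toLp 2 fun _ : Path => ℝ).comp (LipschitzWith.of_dist_le_mul
    fun c c' => (dist_pi_le_iff (by positivity)).2 fun r => (hr r).dist_le_mul c c')⟩

variable [Fintype Arc]

/-- The arc flow as a continuous linear function of the path flow. -/
noncomputable def arcFlowCLM : EuclideanSpace ℝ Path →L[ℝ] EuclideanSpace ℝ Arc :=
  LinearMap.toContinuousLinearMap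
    { toFun := M.net.arcFlow
      map_add' := fun f g => by simp [TransportNetwork.arcFlow, Matrix.mulVec_add]
      map_smul' := fun c f => by simp [TransportNetwork.arcFlow, Matrix.mulVec_smul] }

/-- The sum of the arc values over each path, as a continuous linear map. -/
noncomputable def pathSumCLM : EuclideanSpace ℝ Arc →L[ℝ] EuclideanSpace ℝ Path :=
  LinearMap.toContinuousLinearMap
    { toFun := fun v => WithLp.toLp 2 (M.net.arcIncidenceᵀ *ᵥ v.ofLp)
      map_add' := fun f g => by simp [Matrix.mulVec_add]
      map_smul' := fun c f => by simp [Matrix.mulVec_smul] }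

theorem disutility_eq (t : ℝ) (f : EuclideanSpace ℝ Path) (ξ : EuclideanSpace ℝ (Fin m)) :
    M.disutility t f ξ = M.timeDisutility t (M.pathSumCLM (M.T (M.arcFlowCLM f) ξ)) := rfl

theorem measurable_disutility (ht : 0 < t) (hTmeas : ∀ v, Measurable (M.T v))
    (f : EuclideanSpace ℝ Path) : Measurable (M.disutility t f) :=
  (M.differentiable_timeDisutility ht).continuous.measurable.comp
    (M.pathSumCLM.continuous.measurable.comp (hTmeas _))

theorem continuous_disutility (ht : 0 < t) {ξ : EuclideanSpace ℝ (Fin m)}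
    (hT : Continuous fun v => M.T v ξ) : Continuous fun f => M.disutility t f ξ :=
  (M.differentiable_timeDisutility ht).continuous.comp
    (M.pathSumCLM.continuous.comp (hT.comp M.arcFlowCLM.continuous))

theorem differentiable_disutility (ht : 0 < t) {ξ : EuclideanSpace ℝ (Fin m)}
    (hT : Differentiable ℝ fun v => M.T v ξ) : Differentiable ℝ fun f => M.disutility t f ξ :=
  (M.differentiable_timeDisutility ht).comp
    (M.pathSumCLM.differentiable.comp (hT.comp M.arcFlowCLM.differentiable))

/-- The expected disutility is differentiable, with the expected Jacobian as its derivative. -/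
theorem hasFDerivAt_expDisutility (ht : 0 < t) {P : Measure (EuclideanSpace ℝ (Fin m))}
    (hTmeas : ∀ v, Measurable (M.T v)) (hTdiff : ∀ᵐ ξ ∂P, Differentiable ℝ fun v => M.T v ξ)
    {𝔽 : Set (EuclideanSpace ℝ Path)} {Φ : EuclideanSpace ℝ (Fin m) → ℝ} (hΦ : Integrable Φ P)
    (hlip : ∀ᵐ ξ ∂P, ∀ v ∈ M.net.arcFlow '' 𝔽, ∀ v' ∈ M.net.arcFlow '' 𝔽,
      ‖M.T v ξ - M.T v' ξ‖ ≤ Φ ξ * ‖v - v'‖)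
    {f : EuclideanSpace ℝ Path} (hf : 𝔽 ∈ 𝓝 f) (hint : Integrable (M.disutility t f) P) :
    HasFDerivAt (fun g => M.expDisutility t g P) (M.expJacobian t f P) f := by
  obtain ⟨K, hK⟩ := M.exists_lipschitzWith_timeDisutility ht
  have hmeas g : AEStronglyMeasurable (M.disutility t g) P :=
    (M.measurable_disutility ht hTmeas g).aestronglyMeasurable
  have hdiff : ∀ᵐ ξ ∂P, DifferentiableAt ℝ (fun g => M.disutility t g ξ) f :=
    hTdiff.mono fun ξ hξ => M.differentiable_disutility ht hξ f
  refine (hasFDerivAt_integral_of_dominated_loc_of_lip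
    (bound := fun ξ => K * ‖M.pathSumCLM‖ * ‖M.arcFlowCLM‖ * Φ ξ) hf
    (Eventually.of_forall hmeas) hint
    (aestronglyMeasurable_fderiv_of_ae_differentiableAt hmeas hdiff) ?_ (hΦ.const_mul _)
    (hdiff.mono fun ξ hξ => hξ.hasFDerivAt)).2
  filter_upwards [hlip] with ξ hξ
  refine LipschitzOnWith.of_dist_le_mul fun g hg g' hg' => ?_
  rw [Real.coe_nnabs, disutility_eq, disutility_eq]
  have hT : ‖M.T (M.arcFlowCLM g) ξ - M.T (M.arcFlowCLM g') ξ‖ ≤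
      |Φ ξ| * (‖M.arcFlowCLM‖ * ‖g - g'‖) := by
    refine (hξ _ ⟨g, hg, rfl⟩ _ ⟨g', hg', rfl⟩).trans ?_
    refine (mul_le_mul_of_nonneg_right (le_abs_self _) (norm_nonneg _)).trans ?_
    gcongr
    change ‖M.arcFlowCLM g - M.arcFlowCLM g'‖ ≤ _
    rw [← map_sub]
    exact M.arcFlowCLM.le_opNorm _
  calc _ ≤ K * dist (M.pathSumCLM (M.T (M.arcFlowCLM g) ξ))
        (M.pathSumCLM (M.T (M.arcFlowCLM g') ξ)) := hK.dist_le_mul _ _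
    _ ≤ K * (‖M.pathSumCLM‖ * (|Φ ξ| * (‖M.arcFlowCLM‖ * ‖g - g'‖))) := by
        rw [dist_eq_norm, ← map_sub]
        gcongr
        exact (M.pathSumCLM.le_opNorm _).trans (by gcongr)
    _ = _ := by
        rw [abs_mul, abs_of_nonneg (by positivity : 0 ≤ K * ‖M.pathSumCLM‖ * ‖M.arcFlowCLM‖),
          dist_eq_norm]
        ring

/-! ## Equilibria for the contaminated law -/

/-- An equilibrium for the contaminated law solves the equilibrium problem for the original law
up to a residual proportional to the contamination. -/
theorem mem_equilibria_contaminated {P : Measure (EuclideanSpace ℝ (Fin m))}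
    {ξ' : EuclideanSpace ℝ (Fin m)} {s : ℝ} (hs₀ : 0 < s) (hs₁ : s < 1)
    {f : EuclideanSpace ℝ Path} (hf : f ∈ M.equilibria t (contaminated P ξ' s)) :
    Integrable (M.disutility t f) P ∧
      s • (M.expDisutility t f P - M.disutility t f ξ') - M.expDisutility t f P ∈
        normalCone M.D f := by
  obtain ⟨hint, w, hw, h0⟩ := hf
  -- The weight `1 - s` is nonzero, so integrability passes from the mixture to `P`.
  have hP : Integrable (M.disutility t f) P :=
    (integrable_smul_measure (ENNReal.ofReal_pos.2 (sub_pos.2 hs₁)).ne'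
      ENNReal.ofReal_ne_top).1 hint.left_of_add_measure
  refine ⟨hP, ?_⟩
  have hexp : M.expDisutility t f (contaminated P ξ' s) =
      (1 - s) • M.expDisutility t f P + s • M.disutility t f ξ' := by
    unfold expDisutility contaminated
    rw [integral_add_measure hint.left_of_add_measure hint.right_of_add_measure,
      integral_smul_measure, integral_smul_measure, integral_dirac,
      ENNReal.toReal_ofReal (sub_pos.2 hs₁).le, ENNReal.toReal_ofReal hs₀.le]
  convert hw using 1
  rw [hexp] at h0
  rw [eq_neg_of_add_eq_zero_right h0.symm]
  module

theorem mem_equilibriumMap_of_contaminated {P : Measure (EuclideanSpace ℝ (Fin m))}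
    {ξ' : EuclideanSpace ℝ (Fin m)} {s : ℝ} (hs₀ : 0 < s) (hs₁ : s < 1)
    {f : EuclideanSpace ℝ Path} (hf : f ∈ M.equilibria t (contaminated P ξ' s)) :
    s • (M.expDisutility t f P - M.disutility t f ξ') ∈ M.equilibriumMap t P f := by
  obtain ⟨hint, hw⟩ := M.mem_equilibria_contaminated hs₀ hs₁ hf
  exact ⟨hint, _, hw, by abel⟩

/-- The elements of the generalized influence function are limits of scaled contaminated
equilibria. -/
theorem exists_seq_of_mem_GIF {P : Measure (EuclideanSpace ℝ (Fin m))}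
    {f : EuclideanSpace ℝ Path} {ξ' : EuclideanSpace ℝ (Fin m)} {η : EuclideanSpace ℝ Path}
    (hη : η ∈ M.GIF t P f ξ') :
    ∃ (ε d : ℕ → ℝ) (η' : ℕ → EuclideanSpace ℝ Path), (∀ n, 0 < ε n) ∧
      Tendsto ε atTop (𝓝 0) ∧ Tendsto d atTop (𝓝 1) ∧ Tendsto η' atTop (𝓝 η) ∧
      ∀ n, 0 < ε n * d n ∧ ε n * d n < 1 ∧
        f + ε n • η' n ∈ M.equilibria t (contaminated P ξ' (ε n * d n)) := by
  obtain ⟨ε, d, η', hε, hε0, hd, hη', hmem⟩ := hη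
  have hs : Tendsto (fun n => ε n * d n) atTop (𝓝 0) := by simpa using hε0.mul hd
  -- Early weights `ε n * d n` may leave `[0, 1]`, where `ENNReal.ofReal` truncates and the measure
  -- is no longer the mixture; these terms are dropped.
  obtain ⟨N, hN⟩ := eventually_atTop.1
    ((hd.eventually_const_lt one_pos).and (hs.eventually_lt_const one_pos))
  have hshift := tendsto_add_atTop_nat N
  refine ⟨fun n => ε (n + N), fun n => d (n + N), fun n => η' (n + N), fun n => hε _,
    hε0.comp hshift, hd.comp hshift, hη'.comp hshift, fun n => ?_⟩
  obtain ⟨h₁, h₂⟩ := hN (n + N) (Nat.le_add_left _ _)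
  exact ⟨mul_pos (hε _) h₁, h₂, by simpa only [zero_add, smul_eq_mul] using hmem (n + N)⟩

/-- The generalized influence function solves the perturbed linearized generalized equation. -/
theorem GIF_subset {P : Measure (EuclideanSpace ℝ (Fin m))} {f : EuclideanSpace ℝ Path}
    {J : EuclideanSpace ℝ Path →L[ℝ] EuclideanSpace ℝ Path}
    (hJ : HasFDerivAt (fun g => M.expDisutility t g P) J f) {ξ' : EuclideanSpace ℝ (Fin m)}
    (hcont : Continuous fun g => M.disutility t g ξ') :
    M.GIF t P f ξ' ⊆ {η | M.expDisutility t f P - M.disutility t f ξ' - J η ∈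
      protoDeriv (normalCone M.D) f (-M.expDisutility t f P) η} := by
  intro η hη
  obtain ⟨ε, d, η', hε, hε0, hd, hη', hmem⟩ := M.exists_seq_of_mem_GIF hη
  have hfn : Tendsto (fun n => f + ε n • η' n) atTop (𝓝 f) := by
    simpa using (hε0.smul hη').const_add f
  have hquot : Tendsto (fun n => (ε n)⁻¹ • (M.expDisutility t (f + ε n • η' n) P -
      M.expDisutility t f P)) atTop (𝓝 (J η)) := by
    refine (hasFDerivWithinAt_univ.2 hJ).lim (by simpa using hε0.smul hη')
      (Eventually.of_forall fun _ => Set.mem_univ _) (hη'.congr fun n => ?_)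
    rw [smul_smul, inv_mul_cancel₀ (hε n).ne', one_smul]
  -- The witness is the contaminated normal vector minus the reference `-φ(f)`, divided by `ε n`.
  refine ⟨ε, η', fun n => d n • (M.expDisutility t (f + ε n • η' n) P -
      M.disutility t (f + ε n • η' n) ξ') - (ε n)⁻¹ • (M.expDisutility t (f + ε n • η' n) P -
      M.expDisutility t f P), hε, hε0, hη', ?_, fun n => ?_⟩
  · have h₁ := hJ.continuousAt.tendsto.comp hfn
    have h₂ := (hcont.tendsto f).comp hfn
    simpa [Function.comp_def] using (hd.smul (h₁.sub h₂)).sub hquot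
  · convert (M.mem_equilibria_contaminated (hmem n).1 (hmem n).2.1 (hmem n).2.2).2 using 1
    rw [smul_sub (ε n), smul_smul, smul_smul, mul_inv_cancel₀ (hε n).ne', one_smul]
    abel

/-- Under strong metric regularity, the generalized influence function is bounded by the effect of
the contamination on the expected disutility at the equilibrium. -/
theorem norm_le_of_mem_GIF {P : Measure (EuclideanSpace ℝ (Fin m))} {f : EuclideanSpace ℝ Path}
    (hf : f ∈ M.equilibria t P) (hφ : ContinuousAt (fun g => M.expDisutility t g P) f)
    {ξ' : EuclideanSpace ℝ (Fin m)} (hcont : Continuous fun g => M.disutility t g ξ') {γ : ℝ}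
    (hγ : StronglyMetricallyRegular (M.equilibriumMap t P) f 0 γ) {η : EuclideanSpace ℝ Path}
    (hη : η ∈ M.GIF t P f ξ') :
    ‖η‖ ≤ γ * ‖M.expDisutility t f P - M.disutility t f ξ'‖ := by
  obtain ⟨ε, d, η', hε, hε0, hd, hη', hmem⟩ := M.exists_seq_of_mem_GIF hη
  have hfn : Tendsto (fun n => f + ε n • η' n) atTop (𝓝 f) := by
    simpa using (hε0.smul hη').const_add f
  have hlim : Tendsto (fun n => γ * ‖d n • (M.expDisutility t (f + ε n • η' n) P -
      M.disutility t (f + ε n • η' n) ξ')‖) atTop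
      (𝓝 (γ * ‖M.expDisutility t f P - M.disutility t f ξ'‖)) := by
    have h₁ := hφ.tendsto.comp hfn
    have h₂ := (hcont.tendsto f).comp hfn
    simpa [Function.comp_def] using ((hd.smul (h₁.sub h₂)).norm.const_mul γ)
  refine le_of_tendsto_of_tendsto hη'.norm hlim ?_
  filter_upwards [hfn.eventually (hγ.eventually_norm_sub_le hf)] with n hn
  have h := hn _ (M.mem_equilibriumMap_of_contaminated (hmem n).1 (hmem n).2.1 (hmem n).2.2)
  -- Both sides carry the factor `‖ε n‖`, which cancels; only `d n → 1` remains of the weight.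
  rw [add_sub_cancel_left, sub_zero, mul_smul, norm_smul, norm_smul (ε n), mul_left_comm] at h
  exact le_of_mul_le_mul_left h (norm_pos_iff.2 (hε n).ne')

end MLAPUEModel

theorem theorem3p1 {Node Arc OD Path : Type*} [Fintype Arc] [Fintype Path] {m : ℕ}
    (M : MLAPUEModel Node Arc OD Path m) (t : ℝ) (ht : 0 < t)
    -- the support and the law of the random factors
    (Ξ : Set (EuclideanSpace ℝ (Fin m))) (hΞ : IsCompact Ξ)
    (P : Measure (EuclideanSpace ℝ (Fin m))) [IsProbabilityMeasure P] (hP : P Ξᶜ = 0)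
    -- a compact convex set that contains a neighbourhood of the set of equilibria
    (𝔽 : Set (EuclideanSpace ℝ Path)) (h𝔽c : IsCompact 𝔽) (h𝔽v : Convex ℝ 𝔽)
    (h𝔽 : ∃ b > 0, ∀ f ∈ M.equilibria t P, Metric.closedBall f b ⊆ 𝔽)
    -- the travel times depend measurably on the random factors and continuously on the flow
    (hTmeas : ∀ v, Measurable (M.T v))
    (hTcont : ∀ ξ, Continuous fun v => M.T v ξ)
    -- assumptions on the travel times over the support
    (hTdiff : ∀ ξ ∈ Ξ, ContDiff ℝ 1 fun v => M.T v ξ)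
    (hTbound : ∃ Φ₁ : EuclideanSpace ℝ (Fin m) → ℝ, Integrable Φ₁ P ∧
      ∀ ξ ∈ Ξ, ∀ v ∈ M.net.arcFlow '' 𝔽, ‖M.T v ξ‖ ≤ Φ₁ ξ)
    (hTlip : ∃ Φ₂ : EuclideanSpace ℝ (Fin m) → ℝ, (∀ ξ, 0 < Φ₂ ξ) ∧ Integrable Φ₂ P ∧
      ∀ ξ ∈ Ξ, ∀ v ∈ M.net.arcFlow '' 𝔽, ∀ v' ∈ M.net.arcFlow '' 𝔽,
        ‖M.T v ξ - M.T v' ξ‖ ≤ Φ₂ ξ * ‖v - v'‖)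
    -- an equilibrium, at which the linearized generalized equation has only the solution `0`
    (f : EuclideanSpace ℝ Path) (hf : f ∈ M.equilibria t P)
    (hlin : {g | ∃ w ∈ protoDeriv (normalCone M.D) f (-M.expDisutility t f P) g,
      M.expJacobian t f P g + w = 0} = {0}) :
    (∀ ξ', Bornology.IsBounded (M.GIF t P f ξ')) ∧
    ∀ γ : ℝ, StronglyMetricallyRegular (M.equilibriumMap t P) f 0 γ →
      ⨆ ξ', M.normGIF t P f ξ' ≤
        ENNReal.ofReal γ * ⨆ g ∈ 𝔽, ⨆ ξ', ‖M.expDisutility t g P - M.disutility t g ξ'‖ₑ := by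
  have hsupp : ∀ᵐ ξ ∂P, ξ ∈ Ξ := by
    rw [ae_iff]
    exact hP
  obtain ⟨b, hb, hball⟩ := h𝔽
  obtain ⟨Φ, -, hΦ, hlip⟩ := hTlip
  have hnhds : 𝔽 ∈ 𝓝 f := mem_of_superset (Metric.closedBall_mem_nhds f hb) (hball f hf)
  have hJ := M.hasFDerivAt_expDisutility ht hTmeas
    (hsupp.mono fun ξ hξ => (hTdiff ξ hξ).differentiable one_ne_zero) hΦ
    (hsupp.mono fun ξ hξ => hlip ξ hξ) hnhds hf.1
  refine ⟨fun ξ' => ?_, fun γ hγ => iSup_le fun ξ' => sInf_le fun η hη => ?_⟩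
  · refine (isBounded_linearized_preimage _ (fun g w hw h0 => ?_) _).subset
      (M.GIF_subset hJ (M.continuous_disutility ht (hTcont ξ')))
    have hg : g ∈ {g | ∃ w ∈ protoDeriv (normalCone M.D) f (-M.expDisutility t f P) g,
      M.expJacobian t f P g + w = 0} := ⟨w, hw, h0⟩
    rw [hlin] at hg
    exact hg
  · have h := M.norm_le_of_mem_GIF hf hJ.continuousAt
      (M.continuous_disutility ht (hTcont ξ')) hγ hη
    calc ‖η‖ₑ ≤ ENNReal.ofReal γ * ‖M.expDisutility t f P - M.disutility t f ξ'‖ₑ := by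
          rw [← ofReal_norm, ← ofReal_norm, ← ENNReal.ofReal_mul hγ.1.1.le]
          exact ENNReal.ofReal_le_ofReal h
      _ ≤ _ := by
          gcongr
          exact le_iSup₂_of_le f (mem_of_mem_nhds hnhds) (le_iSup_of_le ξ' le_rfl)
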